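/- **Theorem.** There is a universal constant $C>0$ such that the following holds for every $d\in\mathbb{N}$. There is a stochastic online embedding of $(\mathbb{R}^d,\|\cdot\|_2)$ into an ultrametric (a 2-HST) with expected distortion at most $C\sqrt d\,(1+\log\Phi)$; in particular the expected distortion is $O(\sqrt d\cdot\log\Phi)$ when the aspect ratio satisfies $\Phi\ge 2$. The aspect ratio $\Phi$ and the number of points need not be known in advance. In detail: there are a probability space $(\Omega,P)$, an ultrametric space $(Y,d_Y)$, and for each $\omega\in\Omega$ an online embedding rule, both independent of the input, that is, a rule that assigns to every finite sequence $x=(x_1,\dots,x_n)$ in $\mathbb{R}^d$ a map $f_n=f_{n}^{\omega,x}:\{x_1,\dots,x_n\}\to Y$ which depends only on $\omega$ and $x_1,\dots,x_n$ and is such that the map $f_{n+1}$ assigned to $(x_1,\dots,x_{n+1})$ extends the map $f_n$ assigned to $(x_1,\dots,x_n)$, with the following properties. 1. (Dominating) For every $\omega$, every sequence and all $i,j\le n$: $\|x_i-x_j\|_2\le d_Y(f_n(x_i),f_n(x_j))$. 2. (2-HST) For every $\omega$ and every sequence with $n\ge1$, the metric space $f_n(\{x_1,\dots,x_n\})\subseteq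 Y$ is a 2-HST. 3. (Expected distortion) For every fixed sequence $x_1,\dots,x_n$ and all $i,j\le n$, the random variable $d_Y(f_n(x_i),f_n(x_j))$ is integrable and $$\mathbb{E}\big[d_Y(f_n(x_i),f_n(x_j))\big]\le C\sqrt d\,(1+\log\Phi)\cdot\|x_i-x_j\|_2 ,$$ where $\Phi=\max_{a,b}\|x_a-x_b\|_2\,/\min_{x_a\ne x_b}\|x_a-x_b\|_2$ is the aspect ratio of $\{x_1,\dots,x_n\}$ (if all the points coincide, both sides of the inequality are $0$). Here a metric space $(X,d_X)$ is a $k$-HST if there are a rooted tree $T$, a bijection $\varphi$ from $X$ to the leaves of $T$, and a label $\Gamma_v\in\mathbb{R}$ for each node $v$ of $T$ such that $\Gamma_v=0$ for each leaf $v$, $\Gamma_v\ge k\,\Gamma_u$ whenever $u$ is a child of $v$, and $d_X(x,y)=\Gamma_{\mathrm{lca}(\varphi(x),\varphi(y))}$ for all $x,y\in X$. -/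

import Mathlib

open MeasureTheory

universe u v

/-- A metric space `X` is a `k`-hierarchically well-separated tree (`k`-HST): there are a rooted
tree `T` (with the root as its bottom element, so that ancestors are smaller, `v ⋖ w` says that
`w` is a child of `v`, the maximal elements are the leaves, and `v ⊓ w` is the least common
ancestor), a bijection `φ` from `X` to the leaves of `T`, and labels `Γ` of the nodes, such that
leaves have label `0`, labels decrease by a factor of at least `k` from a node to its children, and
`dist x y` is the label of the least common ancestor of `φ x` and `φ y`. -/
def IsHST (k : ℝ) (X : Type u) [MetricSpace X] : Prop :=
  ∃ (T : RootedTree.{u}) (φ : X ≃ {v : T // IsMax v}) (Γ : T → ℝ),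
    (∀ v : T, IsMax v → Γ v = 0) ∧
    (∀ v w : T, v ⋖ w → k * Γ w ≤ Γ v) ∧
    (∀ x y : X, dist x y = Γ ((φ x : T) ⊓ (φ y : T)))

/-- A (deterministic) rule that embeds points of `X`, arriving one by one, into `Y`. After the
points `x 0, …, x (n - 1)` have arrived, it holds a map `embed x` from the set of these points
to `Y`, which depends on these points only; when one more point arrives, the new map extends
the old one. -/
structure OnlineEmbedding (X : Type u) (Y : Type v) where
  embed : ∀ {n : ℕ} (x : Fin n → X), Set.range x → Y
  extends_prev : ∀ {n : ℕ} (x : Fin (n + 1) → X) (i : Fin n),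
    embed x ⟨x i.castSucc, i.castSucc, rfl⟩ =
      embed (fun j : Fin n => x j.castSucc) ⟨x i.castSucc, i, rfl⟩

/-- The embedding never decreases a distance, whatever the sequence of points. -/
def OnlineEmbedding.IsDominating {X : Type u} {Y : Type v} [MetricSpace X] [MetricSpace Y]
    (A : OnlineEmbedding X Y) : Prop :=
  ∀ (n : ℕ) (x : Fin n → X) (p q : Set.range x), dist p q ≤ dist (A.embed x p) (A.embed x q)

/-- On every sequence of points and at all times, the image of the (at least one) points that have
arrived so far, with the metric of `Y`, is a `k`-HST. -/
def OnlineEmbedding.IsIntoHST {X : Type u} {Y : Type v} [MetricSpace Y] (k : ℝ)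
    (A : OnlineEmbedding X Y) : Prop :=
  ∀ (n : ℕ) (x : Fin n → X), 0 < n → IsHST k (Set.range (A.embed x))

/-- The random online embedding `A ω`, with `ω` distributed according to `P`, has expected
distortion at most `t x` on every fixed finite sequence `x` (the randomness does not depend
on `x`: the adversary is oblivious). -/
def HasExpectedDistortion {Ω : Type*} [MeasurableSpace Ω] {X : Type u} {Y : Type v}
    [MetricSpace X] [MetricSpace Y] (P : Measure Ω) (A : Ω → OnlineEmbedding X Y)
    (t : ∀ {n : ℕ}, (Fin n → X) → ℝ) : Prop :=
  ∀ (n : ℕ) (x : Fin n → X) (p q : Set.range x),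
    Integrable (fun ω => dist ((A ω).embed x p) ((A ω).embed x q)) P ∧
      ∫ ω, dist ((A ω).embed x p) ((A ω).embed x q) ∂P ≤ t x * dist p q

/-- The aspect ratio of a finite sequence of points: the largest distance divided by the smallest
distance between distinct points (`0 / 0 = 0` if all the points coincide). -/
noncomputable def aspectRatio {X : Type u} [MetricSpace X] {n : ℕ} (x : Fin n → X) : ℝ :=
  Metric.diam (Set.range x) / (Set.range x).infsep

/-! The core is one random partition of the space into sets of diameter at most 1 that separates `u`
from `v` with probability at most `300 * √d * dist u v` (`exists_measure_carvingLabel_ne_le`). It is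
drawn once, before any input, and its dilates by all powers of two are used simultaneously; the
scales are correlated, but linearity of expectation makes this harmless. A point is sent to the
sequence of its labels at all scales, and two sequences have distance `2 ^ (i + 1)`, where `i` is
the largest scale at which they differ. This map is fixed once the first point has been moved to the
origin, so it is online without knowledge of `Φ` or `n`. The cell of the origin contains a ball of
radius 1/4, so at all large scales a point has the origin's label and the distances are finite.

For points at distance `D` and norms at most `M`, separation at scale `i` costs `2 ^ (i + 1)` and
has probability at most of order `√d * D / 2 ^ i`. Each scale thus contributes `O(√d * D)`; only
about `log (M / D)` scales matter, since lower ones cost at most `2 * D` together and higher ones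
never separate (`integral_dist_address_le`).

The partition carves out independent random balls of centre `c` and squared radius `s / 4`, with `s`
uniform in `[0, 1]`. Given `c`, the separation probability is at most the positive part of `4‖v -
c‖² - 4‖u - c‖²`, whose linear term `-8⟪v - u, c - u⟫` has size `dist u v / √d` on average over the
ball of radius 1/2 about `u`. The average chance of containing `u` is at least of order `1 / d`, and
the quotient gives `√d` (`measure_ballHits_diff_le_mul`). By `infinitePi_first_hit_le`, this
quotient governs the first ball that meets the pair. -/

/-! ### Finite ultrametric spaces as trees of balls -/

/-- In a finite partial order whose lower sets are chains, every element other than the bottom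
has a largest strictly smaller element. -/
theorem nonempty_predOrder_of_finite (T : Type*) [PartialOrder T] [OrderBot T] [Finite T]
    (hT : ∀ a b c : T, a ≤ c → b ≤ c → a ≤ b ∨ b ≤ a) : Nonempty (PredOrder T) := by
  classical
  have key : ∀ c : T, c ≠ ⊥ → ∃ p, p < c ∧ ∀ a, a < c → a ≤ p := by
    intro c hc
    obtain ⟨p, hp, hmax⟩ := (Set.toFinite (Set.Iio c)).exists_maximal ⟨⊥, bot_lt_iff_ne_bot.2 hc⟩
    refine ⟨p, hp, fun a ha => ?_⟩
    rcases hT a p c ha.le (le_of_lt hp) with h | h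
    · exact h
    · exact hmax ha h
  choose p hp hmax using key
  refine ⟨⟨fun c => if h : c = ⊥ then ⊥ else p c h, fun c => ?_, fun {c} h => ?_, fun {a b} h => ?_⟩⟩
  · split_ifs with h
    · exact bot_le
    · exact (hp c h).le
  · split_ifs at h with hc
    · rw [hc]; exact isMin_bot
    · exact absurd (hp c hc) h.not_gt
  · have hb : b ≠ ⊥ := (bot_le.trans_lt h).ne'
    simpa [hb] using hmax b hb a h

/-- The closed balls of nonnegative radius in a metric space; they are the nodes of a tree, ordered
by reverse inclusion. -/
def BallNode (X : Type u) [MetricSpace X] : Type u :=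
  {S : Set X // ∃ x r, 0 ≤ r ∧ S = Metric.closedBall x r}

namespace BallNode

variable {X : Type u} [MetricSpace X]

instance : PartialOrder (BallNode X) :=
  PartialOrder.lift (fun S => OrderDual.toDual S.1) fun _ _ h => Subtype.ext h

theorem le_iff {S S' : BallNode X} : S ≤ S' ↔ S'.1 ⊆ S.1 := Iff.rfl

theorem nonempty (S : BallNode X) : S.1.Nonempty := by
  obtain ⟨x, r, hr, h⟩ := S.2
  exact ⟨x, h ▸ Metric.mem_closedBall_self hr⟩

instance [Finite X] : Finite (BallNode X) := by
  unfold BallNode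
  infer_instance

/-- Every point of an ultrametric ball is a centre, so its diameter is at most its radius and can
replace it. Balls with a common point are then compared by diameter alone. -/
theorem eq_closedBall_diam [Finite X] [IsUltrametricDist X] (S : BallNode X) {x : X}
    (hx : x ∈ S.1) : S.1 = Metric.closedBall x (Metric.diam S.1) := by
  obtain ⟨c, r, hr, h⟩ := S.2
  have h' : S.1 = Metric.closedBall x r := by
    rw [h, IsUltrametricDist.closedBall_eq_of_mem (h ▸ hx)]
  have hd : Metric.diam S.1 ≤ r := by
    refine Metric.diam_le_of_forall_dist_le hr fun y hy z hz => ?_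
    have hz' : z ∈ Metric.closedBall x r := h' ▸ hz
    rw [h', IsUltrametricDist.closedBall_eq_of_mem hz'] at hy
    exact hy
  refine Set.Subset.antisymm (fun y hy => ?_) ?_
  · exact Metric.dist_le_diam_of_mem (Set.toFinite _).isBounded hy hx
  · exact (Metric.closedBall_subset_closedBall hd).trans h'.ge

/-- The smallest ball containing a nonempty finite set. -/
noncomputable def hull (A : Set X) (hA : A.Nonempty) : BallNode X :=
  ⟨Metric.closedBall hA.some (Metric.diam A), _, _, Metric.diam_nonneg, rfl⟩

theorem subset_hull [Finite X] (A : Set X) (hA : A.Nonempty) : A ⊆ (hull A hA).1 :=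
  fun _ hy => Metric.dist_le_diam_of_mem (Set.toFinite _).isBounded hy hA.some_mem

theorem le_hull [Finite X] [IsUltrametricDist X] {A : Set X} (hA : A.Nonempty) {S : BallNode X}
    (h : A ⊆ S.1) : S ≤ hull A hA := by
  rw [le_iff, S.eq_closedBall_diam (h hA.some_mem)]
  exact Metric.closedBall_subset_closedBall (Metric.diam_mono h (Set.toFinite _).isBounded)

theorem diam_hull [Finite X] [IsUltrametricDist X] (A : Set X) (hA : A.Nonempty) :
    Metric.diam (hull A hA).1 = Metric.diam A := by
  refine le_antisymm ?_ (Metric.diam_mono (subset_hull A hA) (Set.toFinite _).isBounded)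
  refine Metric.diam_le_of_forall_dist_le Metric.diam_nonneg fun y hy z hz => ?_
  exact (dist_triangle_max y hA.some z).trans (max_le hy (by rw [dist_comm]; exact hz))

noncomputable instance [Finite X] [IsUltrametricDist X] : SemilatticeInf (BallNode X) where
  inf S S' := hull (S.1 ∪ S'.1) (S.nonempty.mono Set.subset_union_left)
  inf_le_left _ _ := Set.subset_union_left.trans (subset_hull _ _)
  inf_le_right _ _ := Set.subset_union_right.trans (subset_hull _ _)
  le_inf _ _ _ h h' := le_hull _ (Set.union_subset h h')

theorem inf_eq_hull [Finite X] [IsUltrametricDist X] (S S' : BallNode X) :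
    S ⊓ S' = hull (S.1 ∪ S'.1) (S.nonempty.mono Set.subset_union_left) := rfl

noncomputable instance [Finite X] [Nonempty X] : OrderBot (BallNode X) where
  bot := hull Set.univ Set.univ_nonempty
  bot_le S := (Set.subset_univ S.1).trans (subset_hull _ _)

theorem le_total_of_le [Finite X] [IsUltrametricDist X] (a b c : BallNode X) (ha : a ≤ c)
    (hb : b ≤ c) : a ≤ b ∨ b ≤ a := by
  obtain ⟨x, hx⟩ := c.nonempty
  rw [le_iff, le_iff, a.eq_closedBall_diam (ha hx), b.eq_closedBall_diam (hb hx)]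
  rcases le_total (Metric.diam a.1) (Metric.diam b.1) with h | h
  · exact Or.inr (Metric.closedBall_subset_closedBall h)
  · exact Or.inl (Metric.closedBall_subset_closedBall h)

/-- The ball of radius zero around a point. -/
def leaf (x : X) : BallNode X := ⟨{x}, x, 0, le_rfl, Metric.closedBall_zero.symm⟩

theorem isMax_leaf (x : X) : IsMax (leaf x) := by
  intro S hS
  obtain ⟨y, hy⟩ := S.nonempty
  have hyx : y = x := hS hy
  exact fun z hz => (hz : z = x) ▸ hyx ▸ hy

theorem eq_leaf_of_isMax {S : BallNode X} (hS : IsMax S) {x : X} (hx : x ∈ S.1) : S = leaf x :=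
  hS.eq_of_le (Set.singleton_subset_iff.2 hx)

/-- The points correspond to the leaves of the tree of balls. -/
noncomputable def leafEquiv : X ≃ {S : BallNode X // IsMax S} :=
  Equiv.ofBijective (fun x => ⟨leaf x, isMax_leaf x⟩)
    ⟨fun _ _ h => Set.singleton_injective (congrArg (fun S => S.1.1) h), fun S =>
      ⟨S.1.nonempty.some, Subtype.ext (eq_leaf_of_isMax S.2 S.1.nonempty.some_mem).symm⟩⟩

end BallNode

/-- A finite ultrametric space in which distances from a point differ by a factor of at least `k`
unless they are equal is a `k`-HST. -/
theorem isHST_of_finite_ultrametric {k : ℝ} (X : Type u) [MetricSpace X]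
    [IsUltrametricDist X] [Finite X] [Nonempty X]
    (hk : ∀ x y z : X, dist x y < dist x z → k * dist x y ≤ dist x z) : IsHST k X := by
  -- The predecessor structure provides the parents in the rooted tree.
  obtain ⟨hpred⟩ := nonempty_predOrder_of_finite (BallNode X) BallNode.le_total_of_le
  refine ⟨⟨BallNode X⟩, BallNode.leafEquiv, fun S => Metric.diam S.1, fun S hS => ?_,
    fun S S' h => ?_, fun x y => ?_⟩
  · obtain ⟨x, hx⟩ := BallNode.nonempty S
    rw [BallNode.eq_leaf_of_isMax hS hx]
    exact Metric.diam_singleton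
  · obtain ⟨x, hx⟩ := BallNode.nonempty S'
    -- The diameter is attained from `x` itself, so the gap hypothesis `hk`, which concerns
    -- distances from one point, applies.
    obtain ⟨y, hy, hmax⟩ := (Set.toFinite S'.1).exists_maximalFor (dist x) _ ⟨x, hx⟩
    have hd : Metric.diam S'.1 = dist x y := by
      refine le_antisymm ?_ (Metric.dist_le_diam_of_mem (Set.toFinite _).isBounded hx hy)
      have hm : ∀ z ∈ S'.1, dist x z ≤ dist x y := fun z hz => by
        rcases le_total (dist x z) (dist x y) with h | h
        · exact h
        · exact hmax hz h
      refine Metric.diam_le_of_forall_dist_le dist_nonneg fun a ha b hb => ?_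
      exact (dist_triangle_max a x b).trans (max_le (dist_comm a x ▸ hm a ha) (hm b hb))
    obtain ⟨z, hz, hz'⟩ := Set.not_subset.1 (show ¬ S.1 ⊆ S'.1 from h.1.not_ge)
    have hlt : dist x y < dist x z := by
      by_contra! hle
      refine hz' ?_
      rw [BallNode.eq_closedBall_diam S' hx, hd, Metric.mem_closedBall, dist_comm]
      exact hle
    change k * Metric.diam S'.1 ≤ Metric.diam S.1
    rw [hd]
    exact (hk x y z hlt).trans
      (Metric.dist_le_diam_of_mem (Set.toFinite _).isBounded (h.1.le hx) hz)
  · change dist x y = Metric.diam (BallNode.leaf x ⊓ BallNode.leaf y : BallNode X).1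
    rw [BallNode.inf_eq_hull, BallNode.diam_hull]
    change _ = Metric.diam ({x} ∪ {y} : Set X)
    rw [Set.singleton_union, Metric.diam_pair]

/-! ### The ultrametric space of addresses -/

/-- Two-sided sequences that are eventually constant with value `k₀`, thought of as the addresses of
the leaves of an infinite tree. -/
def AddressSpace {K : Type u} (k₀ : K) : Type u :=
  {y : ℤ → K // ∃ N, ∀ i, N ≤ i → y i = k₀}

namespace AddressSpace

variable {K : Type u} {k₀ : K}

open Classical in
/-- The contribution of the `i`-th scale to the distance between two addresses. -/
noncomputable def scaleDist (y z : AddressSpace k₀) (i : ℤ) : ℝ :=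
  if y.1 i = z.1 i then 0 else 2 ^ (i + 1)

theorem scaleDist_nonneg (y z : AddressSpace k₀) (i : ℤ) : 0 ≤ scaleDist y z i := by
  unfold scaleDist
  split_ifs <;> positivity

theorem scaleDist_comm (y z : AddressSpace k₀) (i : ℤ) : scaleDist y z i = scaleDist z y i := by
  unfold scaleDist
  by_cases h : y.1 i = z.1 i
  · rw [if_pos h, if_pos h.symm]
  · rw [if_neg h, if_neg (Ne.symm h)]

theorem exists_forall_ge_eq (y z : AddressSpace k₀) : ∃ N, ∀ i, N ≤ i → y.1 i = z.1 i := by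
  obtain ⟨N, hN⟩ := y.2
  obtain ⟨M, hM⟩ := z.2
  exact ⟨max N M, fun i hi => (hN i (le_of_max_le_left hi)).trans (hM i (le_of_max_le_right hi)).symm⟩

theorem bddAbove_scaleDist (y z : AddressSpace k₀) : BddAbove (Set.range (scaleDist y z)) := by
  obtain ⟨N, hN⟩ := exists_forall_ge_eq y z
  refine ⟨2 ^ (N + 1), ?_⟩
  rintro _ ⟨i, rfl⟩
  unfold scaleDist
  split_ifs with h
  · positivity
  · have : i < N := by
      by_contra! hi
      exact h (hN i hi)
    exact zpow_le_zpow_right₀ one_le_two (by lia)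

noncomputable instance : Dist (AddressSpace k₀) := ⟨fun y z => ⨆ i, scaleDist y z i⟩

theorem dist_eq_iSup (y z : AddressSpace k₀) : dist y z = ⨆ i, scaleDist y z i := rfl

theorem scaleDist_le_dist (y z : AddressSpace k₀) (i : ℤ) : scaleDist y z i ≤ dist y z :=
  le_ciSup (bddAbove_scaleDist y z) i

theorem scaleDist_le_max (x y z : AddressSpace k₀) (i : ℤ) :
    scaleDist x z i ≤ max (scaleDist x y i) (scaleDist y z i) := by
  by_cases hxy : x.1 i = y.1 i <;> by_cases hyz : y.1 i = z.1 i <;> by_cases hxz : x.1 i = z.1 i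
  all_goals simp_all [scaleDist]
  all_goals positivity

theorem dist_le_max (x y z : AddressSpace k₀) : dist x z ≤ max (dist x y) (dist y z) :=
  ciSup_le fun i => (scaleDist_le_max x y z i).trans
    (max_le_max (scaleDist_le_dist x y i) (scaleDist_le_dist y z i))

noncomputable instance : MetricSpace (AddressSpace k₀) where
  dist_self y := by simp [dist_eq_iSup, scaleDist]
  dist_comm y z := congrArg iSup (funext (scaleDist_comm y z))
  dist_triangle x y z := (dist_le_max x y z).trans (max_le_add_of_nonneg
    (Real.iSup_nonneg (scaleDist_nonneg x y)) (Real.iSup_nonneg (scaleDist_nonneg y z)))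
  eq_of_dist_eq_zero {y z} h := by
    refine Subtype.ext (funext fun i => ?_)
    by_contra hne
    have := scaleDist_le_dist y z i
    rw [h, scaleDist, if_neg hne] at this
    exact this.not_gt (by positivity)

instance : IsUltrametricDist (AddressSpace k₀) := ⟨dist_le_max⟩

/-- The distance between different addresses is determined by the largest scale at which they
differ. -/
theorem exists_dist_eq {y z : AddressSpace k₀} (h : y ≠ z) :
    ∃ i, y.1 i ≠ z.1 i ∧ (∀ j, i < j → y.1 j = z.1 j) ∧ dist y z = 2 ^ (i + 1) := by
  obtain ⟨N, hN⟩ := exists_forall_ge_eq y z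
  obtain ⟨i₀, hi₀⟩ : ∃ i, y.1 i ≠ z.1 i := by
    by_contra! H
    exact h (Subtype.ext (funext H))
  obtain ⟨i, hi, hmax⟩ := Int.exists_greatest_of_bdd (P := fun i => y.1 i ≠ z.1 i)
    ⟨N, fun i hi => by
      by_contra! hlt
      exact hi (hN i hlt.le)⟩ ⟨i₀, hi₀⟩
  refine ⟨i, hi, fun j hj => ?_, le_antisymm (ciSup_le fun j => ?_) ?_⟩
  · by_contra hne
    exact (hmax j hne).not_gt hj
  · unfold scaleDist
    split_ifs with hj
    · positivity
    · exact zpow_le_zpow_right₀ one_le_two (by have := hmax j hj; lia)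
  · have := scaleDist_le_dist y z i
    rwa [scaleDist, if_neg hi] at this

/-- Nonzero distances are integer powers of two. -/
theorem two_mul_dist_le_of_lt {x y z : AddressSpace k₀} (h : dist x y < dist x z) :
    2 * dist x y ≤ dist x z := by
  rcases eq_or_ne x y with rfl | hxy
  · simp
  rcases eq_or_ne x z with rfl | hxz
  · exact absurd h (by simp)
  obtain ⟨i, -, -, hi⟩ := exists_dist_eq hxy
  obtain ⟨j, -, -, hj⟩ := exists_dist_eq hxz
  rw [hi, hj] at h ⊢
  have hij := (zpow_lt_zpow_iff_right₀ (one_lt_two : (1 : ℝ) < 2)).1 h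
  rw [mul_comm, ← zpow_add_one₀ two_ne_zero]
  exact zpow_le_zpow_right₀ one_le_two (by lia)

theorem isHST_of_finite (S : Set (AddressSpace k₀)) (hS : S.Finite) (hne : S.Nonempty) :
    IsHST 2 S := by
  have := hS.to_subtype
  have := hne.to_subtype
  exact isHST_of_finite_ultrametric S fun x y z h => two_mul_dist_le_of_lt h

/-- Above scale `m` only scales at which the addresses differ contribute to the distance, and none
above scale `N`. -/
theorem dist_le_add_sum {y z : AddressSpace k₀} {m N : ℤ} (hN : ∀ i, N < i → y.1 i = z.1 i) :
    dist y z ≤ 2 ^ (m + 1) + ∑ i ∈ Finset.Icc (m + 1) N, scaleDist y z i := by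
  have hs : 0 ≤ ∑ i ∈ Finset.Icc (m + 1) N, scaleDist y z i :=
    Finset.sum_nonneg fun i _ => scaleDist_nonneg y z i
  refine ciSup_le fun i => ?_
  rcases le_or_gt i m with him | him
  · refine le_add_of_le_of_nonneg ?_ hs
    unfold scaleDist
    split_ifs
    · positivity
    · exact zpow_le_zpow_right₀ one_le_two (by lia)
  · rcases le_or_gt i N with hiN | hiN
    · exact le_add_of_nonneg_of_le (by positivity) (Finset.single_le_sum
        (f := scaleDist y z) (fun i _ => scaleDist_nonneg y z i) (Finset.mem_Icc.2 ⟨him, hiN⟩))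
    · rw [scaleDist, if_pos (hN i hiN)]
      positivity

end AddressSpace

/-! ### Dilating one partition to all scales -/

section Hierarchy

variable {E : Type u} [NormedAddCommGroup E] [NormedSpace ℝ E] {K : Type v} {k₀ : K}

/-- A labelled partition of a normed space into sets of diameter at most one, one of which contains
the ball of radius `1 / 4` about the origin. -/
structure IsUnitPartition (κ : E → K) (k₀ : K) : Prop where
  dist_le_one : ∀ u v, κ u = κ v → dist u v ≤ 1
  eq_of_norm_le : ∀ u, ‖u‖ ≤ 1 / 4 → κ u = k₀

theorem IsUnitPartition.exists_forall_ge {κ : E → K} (hκ : IsUnitPartition κ k₀) (u : E) :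
    ∃ N : ℤ, ∀ i, N ≤ i → κ ((2 : ℝ) ^ (-i) • u) = k₀ := by
  obtain ⟨n, hn⟩ := pow_unbounded_of_one_lt (4 * ‖u‖) one_lt_two
  refine ⟨n, fun i hi => hκ.eq_of_norm_le _ ?_⟩
  rw [norm_smul, Real.norm_of_nonneg (by positivity), zpow_neg, inv_mul_le_iff₀ (by positivity)]
  have : (2 : ℝ) ^ (n : ℤ) ≤ 2 ^ i := zpow_le_zpow_right₀ one_le_two hi
  rw [zpow_natCast] at this
  linarith

/-- The address of a point in the hierarchy of the dilates of a partition by powers of two. -/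
noncomputable def IsUnitPartition.address {κ : E → K} (hκ : IsUnitPartition κ k₀) (u : E) : AddressSpace k₀ :=
  ⟨fun i => κ ((2 : ℝ) ^ (-i) • u), hκ.exists_forall_ge u⟩

theorem IsUnitPartition.dist_le_of_address_eq {κ : E → K} (hκ : IsUnitPartition κ k₀) {u v : E}
    {i : ℤ} (h : (hκ.address u).1 i = (hκ.address v).1 i) : dist u v ≤ 2 ^ i := by
  have := hκ.dist_le_one _ _ h
  rwa [dist_smul₀, Real.norm_of_nonneg (by positivity), zpow_neg,
    inv_mul_le_iff₀ (by positivity), mul_one] at this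

theorem IsUnitPartition.dist_le_dist_address {κ : E → K} (hκ : IsUnitPartition κ k₀) (u v : E) :
    dist u v ≤ dist (hκ.address u) (hκ.address v) := by
  rcases eq_or_ne (hκ.address u) (hκ.address v) with h | h
  · rw [h, dist_self]
    by_contra! hpos
    obtain ⟨n, hn⟩ := exists_pow_lt_of_lt_one hpos (by norm_num : (1 / 2 : ℝ) < 1)
    have := hκ.dist_le_of_address_eq (i := -n) (congrArg (fun y => y.1 (-n)) h)
    rw [zpow_neg, zpow_natCast] at this
    simp only [one_div, inv_pow] at hn
    exact this.not_gt hn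
  · obtain ⟨i, -, hi, hd⟩ := AddressSpace.exists_dist_eq h
    rw [hd]
    -- The labels agree at scale `i + 1`, where cells have diameter at most `2 ^ (i + 1)`; hence the
    -- exponent in `scaleDist`.
    exact hκ.dist_le_of_address_eq (hi _ (lt_add_one i))

end Hierarchy

/-! ### Online embeddings induced by a fixed map -/

/-- The online embedding that translates the first point to the origin and then applies a fixed
map. -/
def OnlineEmbedding.ofMap {E : Type u} [AddGroup E] {Y : Type v} (f : E → Y) : OnlineEmbedding E Y where
  embed {n} x p := match n, x, p with
    | 0, _, p => f p
    | _ + 1, x, p => f (p - x 0)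
  extends_prev {n} x i := by
    cases n with
    | zero => exact i.elim0
    | succ n => rfl

theorem OnlineEmbedding.exists_embed_ofMap_eq {E : Type u} [AddGroup E] (Y : Type v) {n : ℕ}
    (x : Fin n → E) (p₀ : Set.range x) :
    ∃ c ∈ Set.range x, ∀ (f : E → Y) p, (OnlineEmbedding.ofMap f).embed x p = f (p - c) := by
  cases n with
  | zero => obtain ⟨_, i, _⟩ := p₀; exact i.elim0
  | succ n => exact ⟨x 0, ⟨0, rfl⟩, fun f p => rfl⟩

/-! ### Integrals over balls and the distribution of centres -/

section Ball

open scoped RealInnerProductSpace ENNReal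

variable {E : Type u} [NormedAddCommGroup E] [InnerProductSpace ℝ E] [FiniteDimensional ℝ E]
  [MeasurableSpace E] [BorelSpace E]

/-- A reflection takes `h` to `k` and preserves both the ball and the volume. -/
theorem setLIntegral_closedBall_inner_sq_eq {h k : E} (hk : ‖h‖ = ‖k‖) (r : ℝ) :
    ∫⁻ y in Metric.closedBall 0 r, ENNReal.ofReal (⟪k, y⟫ ^ 2) =
      ∫⁻ y in Metric.closedBall 0 r, ENNReal.ofReal (⟪h, y⟫ ^ 2) := by
  set R := (ℝ ∙ (h - k))ᗮ.reflection with hR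
  have hRh : R h = k := Submodule.reflection_sub hk
  have hpre : R ⁻¹' Metric.closedBall 0 r = Metric.closedBall 0 r := by
    ext y
    simp
  have := R.measurePreserving.setLIntegral_comp_preimage_emb
    R.toHomeomorph.measurableEmbedding (fun y => ENNReal.ofReal (⟪k, y⟫ ^ 2)) (Metric.closedBall 0 r)
  rw [← this, hpre]
  refine lintegral_congr fun y => ?_
  rw [← hRh, LinearIsometryEquiv.inner_map_map]

/-- By symmetry all directions have the same second moment, and over an orthonormal basis these sum
to the integral of `‖y‖²`. -/
theorem finrank_mul_setLIntegral_closedBall_inner_sq_le (h : E) {r : ℝ} :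
    Module.finrank ℝ E * ∫⁻ y in Metric.closedBall 0 r, ENNReal.ofReal (⟪h, y⟫ ^ 2) ≤
      ENNReal.ofReal (‖h‖ ^ 2 * r ^ 2) * volume (Metric.closedBall (0 : E) r) := by
  let b := stdOrthonormalBasis ℝ E
  have hb : ∀ i, ‖h‖ = ‖‖h‖ • b i‖ := fun i => by simp [norm_smul]
  calc Module.finrank ℝ E * ∫⁻ y in Metric.closedBall 0 r, ENNReal.ofReal (⟪h, y⟫ ^ 2)
      = ∑ i, ∫⁻ y in Metric.closedBall 0 r, ENNReal.ofReal (⟪‖h‖ • b i, y⟫ ^ 2) := by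
        simp_rw [setLIntegral_closedBall_inner_sq_eq (hb _)]
        simp
    _ = ∫⁻ y in Metric.closedBall (0 : E) r, ENNReal.ofReal (‖h‖ ^ 2 * ‖y‖ ^ 2) := by
        rw [← lintegral_finsetSum _ (fun i _ => by fun_prop)]
        refine lintegral_congr fun y => ?_
        rw [← ENNReal.ofReal_sum_of_nonneg (fun i _ => sq_nonneg _), ← b.sum_sq_norm_inner_right y,
          Finset.mul_sum]
        simp [real_inner_smul_left, mul_pow]
    _ ≤ ∫⁻ y in Metric.closedBall (0 : E) r, ENNReal.ofReal (‖h‖ ^ 2 * r ^ 2) := by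
        refine setLIntegral_mono measurable_const fun y hy => ?_
        have : ‖y‖ ≤ r := mem_closedBall_zero_iff.1 hy
        gcongr
    _ = _ := by rw [setLIntegral_const]

theorem setLIntegral_closedBall_half_sub_inner_le [Nontrivial E] {h : E}
    (hh : ‖h‖ * √(Module.finrank ℝ E) ≤ 1) :
    ∫⁻ y in Metric.closedBall 0 (1 / 2), ENNReal.ofReal (4 * ‖h‖ ^ 2 - 8 * ⟪h, y⟫) ≤
      ENNReal.ofReal (8 * ‖h‖ / √(Module.finrank ℝ E)) *
        volume (Metric.closedBall (0 : E) (1 / 2)) := by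
  rcases eq_or_ne h 0 with rfl | h0
  · simp
  set n := Module.finrank ℝ E with hn
  set V := volume (Metric.closedBall (0 : E) (1 / 2)) with hV
  have hn0 : 0 < (n : ℝ) := Nat.cast_pos.2 Module.finrank_pos
  have hs : 0 < √(n : ℝ) := Real.sqrt_pos.2 hn0
  have hs2 : √(n : ℝ) ^ 2 = n := Real.sq_sqrt hn0.le
  have hpos : 0 < ‖h‖ := norm_pos_iff.2 h0
  -- `1 / τ` is the bound for the root mean square of `⟪h, y⟫` on the ball. This balances the two
  -- terms of `-8t ≤ 4τt² + 4/τ`, which linearizes the positive part.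
  set τ := 2 * √(n : ℝ) / ‖h‖ with hτ
  have hτ0 : 0 < τ := by positivity
  have hQ : ∫⁻ y in Metric.closedBall 0 (1 / 2), ENNReal.ofReal (⟪h, y⟫ ^ 2) ≤
      ENNReal.ofReal (‖h‖ ^ 2 / (4 * n)) * V := by
    have h1 := finrank_mul_setLIntegral_closedBall_inner_sq_le h (r := 1 / 2)
    have h2 : ENNReal.ofReal (‖h‖ ^ 2 * (1 / 2) ^ 2) = n * ENNReal.ofReal (‖h‖ ^ 2 / (4 * n)) := by
      rw [← ENNReal.ofReal_natCast, ← ENNReal.ofReal_mul hn0.le]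
      congr 1
      field_simp
      norm_num
    rw [h2, mul_assoc] at h1
    refine (ENNReal.mul_le_mul_iff_right ?_ (ENNReal.natCast_ne_top n)).1 h1
    exact_mod_cast hn0.ne'
  calc _ ≤ ∫⁻ y in Metric.closedBall 0 (1 / 2), (ENNReal.ofReal (4 * ‖h‖ ^ 2 + 4 / τ) +
          ENNReal.ofReal (4 * τ) * ENNReal.ofReal (⟪h, y⟫ ^ 2)) := by
        refine lintegral_mono fun y => ?_
        rw [← ENNReal.ofReal_mul (by positivity), ← ENNReal.ofReal_add (by positivity) (by positivity)]
        refine ENNReal.ofReal_le_ofReal ?_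
        have h1 : 0 ≤ 4 / τ * (τ * ⟪h, y⟫ + 1) ^ 2 := by positivity
        have h2 : 4 / τ * (τ * ⟪h, y⟫ + 1) ^ 2 = 4 * τ * ⟪h, y⟫ ^ 2 + 8 * ⟪h, y⟫ + 4 / τ := by
          field_simp
          ring
        linarith
    _ = ENNReal.ofReal (4 * ‖h‖ ^ 2 + 4 / τ) * V + ENNReal.ofReal (4 * τ) *
          ∫⁻ y in Metric.closedBall 0 (1 / 2), ENNReal.ofReal (⟪h, y⟫ ^ 2) := by
        rw [lintegral_add_left measurable_const, setLIntegral_const,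
          lintegral_const_mul _ (by fun_prop)]
    _ ≤ ENNReal.ofReal (4 * ‖h‖ ^ 2 + 4 / τ) * V +
          ENNReal.ofReal (4 * τ) * (ENNReal.ofReal (‖h‖ ^ 2 / (4 * n)) * V) := by gcongr
    _ = ENNReal.ofReal (4 * ‖h‖ ^ 2 + 4 / τ + 4 * τ * (‖h‖ ^ 2 / (4 * n))) * V := by
        rw [← mul_assoc, ← add_mul, ← ENNReal.ofReal_mul (by positivity),
          ← ENNReal.ofReal_add (by positivity) (by positivity)]
    _ ≤ _ := by
        gcongr
        have e1 : 4 / τ = 2 * ‖h‖ / √(n : ℝ) := by rw [hτ]; field_simp; norm_num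
        have e2 : 4 * τ * (‖h‖ ^ 2 / (4 * n)) = 2 * ‖h‖ / √(n : ℝ) := by
          rw [hτ]
          field_simp
          exact hs2
        have e3 : ‖h‖ ^ 2 ≤ ‖h‖ / √(n : ℝ) := by
          rw [le_div_iff₀ hs, pow_two, mul_assoc]
          exact mul_le_of_le_one_right hpos.le hh
        rw [e1, e2]
        have : 8 * ‖h‖ / √(n : ℝ) = 4 * (‖h‖ / √(n : ℝ)) + 2 * ‖h‖ / √(n : ℝ) + 2 * ‖h‖ / √(n : ℝ) := by
          ring
        linarith

theorem one_third_le_div_add_one_pow {n : ℕ} (hn : 0 < n) : 1 / 3 ≤ ((n : ℝ) / (n + 1)) ^ n := by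
  have hn' : (0 : ℝ) < n := Nat.cast_pos.2 hn
  have h1 : (1 + 1 / (n : ℝ)) ^ n ≤ Real.exp 1 := by
    have := pow_le_pow_left₀ (by positivity) (Real.add_one_le_exp (1 / (n : ℝ))) n
    rwa [← Real.exp_nat_mul, mul_one_div_cancel hn'.ne', add_comm] at this
  have h2 : ((n : ℝ) / (n + 1)) ^ n = ((1 + 1 / (n : ℝ)) ^ n)⁻¹ := by
    rw [← inv_pow]
    congr 1
    field_simp
  rw [h2, one_div]
  exact inv_anti₀ (by positivity) (h1.trans (by linarith [Real.exp_one_lt_d9]))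

/-- Shrinking the ball by the factor `n / (n + 1)` keeps a third of its volume, and there the
integrand is already at least `1 / (2n)`. -/
theorem le_setLIntegral_closedBall_half_sub_sq [Nontrivial E] :
    ENNReal.ofReal (1 / (6 * Module.finrank ℝ E)) * volume (Metric.closedBall (0 : E) (1 / 2)) ≤
      ∫⁻ y in Metric.closedBall (0 : E) (1 / 2), ENNReal.ofReal (1 - 4 * ‖y‖ ^ 2) := by
  set n := Module.finrank ℝ E with hn
  have hnp : 0 < n := Module.finrank_pos
  have hn1 : (1 : ℝ) ≤ n := Nat.one_le_cast.2 hnp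
  set ρ : ℝ := n / (n + 1) with hρ
  have hρ0 : 0 ≤ ρ := by positivity
  have hρ1 : ρ ≤ 1 := (div_le_one (by positivity)).2 (by linarith)
  calc _ ≤ ENNReal.ofReal (1 - ρ ^ 2) *
          (ENNReal.ofReal (ρ ^ n) * volume (Metric.closedBall (0 : E) (1 / 2))) := by
        rw [← mul_assoc, ← ENNReal.ofReal_mul (by nlinarith)]
        gcongr
        have h1 : 1 / (2 * (n : ℝ)) ≤ 1 - ρ ^ 2 := by
          rw [hρ, div_pow, one_sub_div (by positivity), div_le_div_iff₀ (by positivity)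
            (by positivity)]
          nlinarith
        have h2 := mul_le_mul h1 (one_third_le_div_add_one_pow hnp) (by norm_num)
          (by nlinarith)
        refine le_trans (le_of_eq ?_) h2
        field_simp
        norm_num
    _ = ENNReal.ofReal (1 - ρ ^ 2) * volume (Metric.closedBall (0 : E) (ρ * (1 / 2))) := by
        rw [Measure.addHaar_closedBall_mul _ _ hρ0 (by norm_num)]
    _ = ∫⁻ y in Metric.closedBall (0 : E) (ρ * (1 / 2)), ENNReal.ofReal (1 - ρ ^ 2) := by
        rw [setLIntegral_const]
    _ ≤ ∫⁻ y in Metric.closedBall (0 : E) (ρ * (1 / 2)), ENNReal.ofReal (1 - 4 * ‖y‖ ^ 2) := by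
        refine setLIntegral_mono (by fun_prop) fun y hy => ENNReal.ofReal_le_ofReal ?_
        have : ‖y‖ ≤ ρ * (1 / 2) := mem_closedBall_zero_iff.1 hy
        nlinarith [norm_nonneg y]
    _ ≤ _ := lintegral_mono_set (Metric.closedBall_subset_closedBall (by linarith))

theorem integrable_exp_neg_norm : Integrable fun x : E => Real.exp (-‖x‖) := by
  set n := Module.finrank ℝ E with hn
  have hint := (integrable_one_add_norm (E := E) (μ := volume) (r := (n + 1 : ℕ))
    (by push_cast; linarith)).const_mul ((n + 1).factorial * Real.exp 1)
  refine hint.mono' (by fun_prop) (Filter.Eventually.of_forall fun x => ?_)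
  have h1 := Real.pow_div_factorial_le_exp (1 + ‖x‖) (by positivity) (n + 1)
  rw [Real.norm_of_nonneg (by positivity), Real.rpow_neg (by positivity), Real.rpow_natCast,
    Real.exp_neg, ← div_eq_mul_inv, inv_le_comm₀ (by positivity) (by positivity), inv_div,
    div_le_iff₀ (by positivity)]
  rw [div_le_iff₀ (by positivity), Real.exp_add] at h1
  linarith

/-- There is a probability measure that is comparable to a multiple of the Lebesgue measure on each
ball of radius `1 / 2`, with constants of comparison that do not depend on the dimension. -/
theorem exists_isProbabilityMeasure_comparable_volume :
    ∃ μ : Measure E, IsProbabilityMeasure μ ∧ ∀ u : E, ∃ m : ℝ≥0∞, m ≠ 0 ∧ m ≠ ∞ ∧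
      m • volume.restrict (Metric.closedBall u (1 / 2)) ≤ μ.restrict (Metric.closedBall u (1 / 2)) ∧
      μ.restrict (Metric.closedBall u (1 / 2)) ≤
        (3 * m) • volume.restrict (Metric.closedBall u (1 / 2)) := by
  set w : E → ℝ≥0∞ := fun x => ENNReal.ofReal (Real.exp (-‖x‖)) with hw
  have hwm : Measurable w := by fun_prop
  set μ₀ : Measure E := volume.withDensity w with hμ₀
  have hZtop : μ₀ Set.univ ≠ ∞ := by
    rw [hμ₀, withDensity_apply _ MeasurableSet.univ, setLIntegral_univ]
    exact (integrable_exp_neg_norm (E := E)).lintegral_lt_top.ne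
  have hZ0 : μ₀ Set.univ ≠ 0 := by
    rw [hμ₀, withDensity_apply _ MeasurableSet.univ, setLIntegral_univ, ← pos_iff_ne_zero]
    refine (lintegral_pos_iff_support hwm).2 ?_
    have : Function.support w = Set.univ := by
      ext x
      simp [hw, Real.exp_pos]
    rw [this]
    exact NeZero.pos _
  set Z := μ₀ Set.univ with hZ
  refine ⟨Z⁻¹ • μ₀, ⟨?_⟩, fun u => ?_⟩
  · rw [Measure.smul_apply, smul_eq_mul, ENNReal.inv_mul_cancel hZ0 hZtop]
  set B := Metric.closedBall u (1 / 2) with hB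
  have hBm : MeasurableSet B := Metric.isClosed_closedBall.measurableSet
  set e := ENNReal.ofReal (Real.exp (-‖u‖ - 1 / 2)) with he
  have hnorm : ∀ x ∈ B, ‖x‖ ≤ ‖u‖ + 1 / 2 ∧ ‖u‖ ≤ ‖x‖ + 1 / 2 := fun x hx => by
    have h1 : ‖x - u‖ ≤ 1 / 2 := mem_closedBall_iff_norm.1 hx
    have h2 := abs_le.1 ((abs_norm_sub_norm_le x u).trans h1)
    constructor <;> linarith [h2.1, h2.2]
  have hlow : e • volume.restrict B ≤ μ₀.restrict B := by
    rw [hμ₀, restrict_withDensity hBm, ← withDensity_const]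
    refine withDensity_mono ((ae_restrict_iff' hBm).2 (Filter.Eventually.of_forall fun x hx => ?_))
    exact ENNReal.ofReal_le_ofReal (Real.exp_le_exp.2 (by linarith [(hnorm x hx).1]))
  have hupp : μ₀.restrict B ≤ (3 * e) • volume.restrict B := by
    rw [hμ₀, restrict_withDensity hBm, ← withDensity_const]
    refine withDensity_mono ((ae_restrict_iff' hBm).2 (Filter.Eventually.of_forall fun x hx => ?_))
    have h3 : (3 : ℝ≥0∞) = ENNReal.ofReal 3 := by norm_num
    rw [he, h3, ← ENNReal.ofReal_mul (by norm_num)]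
    refine ENNReal.ofReal_le_ofReal ?_
    -- The norm varies by at most 1 over the ball, so the density varies by a factor of at most `e <
    -- 3`.
    calc Real.exp (-‖x‖) ≤ Real.exp (1 + (-‖u‖ - 1 / 2)) :=
          Real.exp_le_exp.2 (by linarith [(hnorm x hx).2])
      _ = Real.exp 1 * Real.exp (-‖u‖ - 1 / 2) := Real.exp_add _ _
      _ ≤ 3 * Real.exp (-‖u‖ - 1 / 2) := by
          gcongr
          linarith [Real.exp_one_lt_d9]
  refine ⟨Z⁻¹ * e, ?_, ?_, ?_, ?_⟩
  · exact mul_ne_zero (ENNReal.inv_ne_zero.2 hZtop) (by simp [he, Real.exp_pos])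
  · exact ENNReal.mul_ne_top (ENNReal.inv_ne_top.2 hZ0) ENNReal.ofReal_ne_top
  · rw [Measure.restrict_smul, mul_smul]
    gcongr
  · rw [Measure.restrict_smul, mul_left_comm, mul_smul]
    gcongr

end Ball

/-! ### Carving a space by a sequence of sets -/

section Carving

variable {E : Type u}

open Classical in
/-- Each point is labelled by the first set of the sequence that contains it; a point in none of
them is labelled by itself. -/
noncomputable def carvingLabel (S : ℕ → Set E) (u : E) : ℕ ⊕ E :=
  if h : ∃ n, u ∈ S n then Sum.inl (Nat.find h) else Sum.inr u

theorem carvingLabel_eq_inl_iff {S : ℕ → Set E} {u : E} {n : ℕ} :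
    carvingLabel S u = Sum.inl n ↔ u ∈ S n ∧ ∀ j < n, u ∉ S j := by
  classical
  unfold carvingLabel
  split_ifs with h
  · rw [Sum.inl.injEq, Nat.find_eq_iff]
  · simp only [false_iff]
    exact fun h' => h ⟨n, h'.1⟩

theorem carvingLabel_eq_inr {S : ℕ → Set E} {u : E} (h : ∀ n, u ∉ S n) :
    carvingLabel S u = Sum.inr u :=
  dif_neg (by simpa using h)

theorem carvingLabel_eq_iff {S : ℕ → Set E} {u v : E} (huv : u ≠ v) :
    carvingLabel S u = carvingLabel S v ↔
      ∃ n, (u ∈ S n ∧ ∀ j < n, u ∉ S j) ∧ (v ∈ S n ∧ ∀ j < n, v ∉ S j) := by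
  classical
  simp only [← carvingLabel_eq_inl_iff]
  refine ⟨fun h => ?_, fun ⟨n, hu, hv⟩ => hu.trans hv.symm⟩
  by_cases hu : ∃ n, u ∈ S n
  · have : carvingLabel S u = Sum.inl (Nat.find hu) := by
      rw [carvingLabel_eq_inl_iff]
      exact ⟨Nat.find_spec hu, fun j hj => Nat.find_min hu hj⟩
    exact ⟨_, this, h ▸ this⟩
  · push Not at hu
    by_cases hv : ∃ n, v ∈ S n
    · have : carvingLabel S v = Sum.inl (Nat.find hv) := by
        rw [carvingLabel_eq_inl_iff]
        exact ⟨Nat.find_spec hv, fun j hj => Nat.find_min hv hj⟩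
      exact ⟨_, h ▸ this, this⟩
    · push Not at hv
      rw [carvingLabel_eq_inr hu, carvingLabel_eq_inr hv, Sum.inr.injEq] at h
      exact absurd h huv

/-- If two points have different labels, then the first set that contains one of them does not
contain the other one, or there is no such set. -/
theorem exists_separating_of_carvingLabel_ne {S : ℕ → Set E} {u v : E}
    (h : carvingLabel S u ≠ carvingLabel S v) :
    (∃ n, (∀ j < n, u ∉ S j ∧ v ∉ S j) ∧ (u ∈ S n ∧ v ∉ S n ∨ v ∈ S n ∧ u ∉ S n)) ∨
      ∀ n, u ∉ S n ∧ v ∉ S n := by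
  classical
  by_cases hex : ∃ n, u ∈ S n ∨ v ∈ S n
  · refine Or.inl ⟨Nat.find hex, fun j hj => not_or.1 (Nat.find_min hex hj), ?_⟩
    have hj : ∀ j < Nat.find hex, u ∉ S j ∧ v ∉ S j := fun j hj => not_or.1 (Nat.find_min hex hj)
    have : ¬ (u ∈ S (Nat.find hex) ∧ v ∈ S (Nat.find hex)) := fun hb => h <| by
      rw [carvingLabel_eq_inl_iff.2 ⟨hb.1, fun j h => (hj j h).1⟩,
        carvingLabel_eq_inl_iff.2 ⟨hb.2, fun j h => (hj j h).2⟩]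
    have := Nat.find_spec hex
    tauto
  · push Not at hex
    exact Or.inr hex

theorem dist_le_one_of_carvingLabel_eq [PseudoMetricSpace E] {S : ℕ → Set E}
    (hS : ∀ n, ∀ u ∈ S n, ∀ v ∈ S n, dist u v ≤ 1) {u v : E}
    (h : carvingLabel S u = carvingLabel S v) : dist u v ≤ 1 := by
  rcases eq_or_ne u v with rfl | huv
  · simp
  · obtain ⟨n, hu, hv⟩ := (carvingLabel_eq_iff huv).1 h
    exact hS n u hu.1 v hv.1

theorem measurableSet_carvingLabel_eq {Ω : Type*} [MeasurableSpace Ω] {S : Ω → ℕ → Set E}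
    (hS : ∀ n u, MeasurableSet {ω | u ∈ S ω n}) (u v : E) :
    MeasurableSet {ω | carvingLabel (S ω) u = carvingLabel (S ω) v} := by
  rcases eq_or_ne u v with rfl | huv
  · simp
  have hfirst : ∀ n u, MeasurableSet {ω | u ∈ S ω n ∧ ∀ j < n, u ∉ S ω j} := fun n u => by
    have := (hS n u).inter (MeasurableSet.iInter fun j => MeasurableSet.iInter fun _ : j < n =>
      (hS j u).compl)
    convert this using 1
    ext ω
    simp
  simp only [carvingLabel_eq_iff huv, Set.ofPred_exists]
  exact MeasurableSet.iUnion fun n => (hfirst n u).inter (hfirst n v)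

end Carving

/-! ### The first hit among independent samples -/

section FirstHit

open scoped ENNReal

variable {α : Type u} [MeasurableSpace α]

/-- In a sequence of independent samples, the first one to fall into `B` falls into the subset `A`
with probability at most `ν A / ν B`; and almost surely some sample falls into `B`. -/
theorem infinitePi_first_hit_le (ν : Measure α) [IsProbabilityMeasure ν] {A B : Set α}
    (hA : MeasurableSet A) (hB : MeasurableSet B) (hB0 : ν B ≠ 0) :
    Measure.infinitePi (fun _ : ℕ => ν)
      {ω | (∃ n, (∀ j < n, ω j ∉ B) ∧ ω n ∈ A) ∨ ∀ n, ω n ∉ B} ≤ ν A / ν B := by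
  set Q := Measure.infinitePi (fun _ : ℕ => ν)
  have hpow : ∀ n, Q {ω | ∀ j < n, ω j ∉ B} = (1 - ν B) ^ n := fun n => by
    have := Measure.infinitePi_pi (μ := fun _ : ℕ => ν) (s := Finset.range n) (t := fun _ => Bᶜ)
      (fun _ _ => hB.compl)
    rw [Finset.prod_const, Finset.card_range, prob_compl_eq_one_sub hB] at this
    rw [← this]
    congr 1
    ext ω
    simp [Set.mem_pi]
  have hhit : ∀ n, Q {ω | (∀ j < n, ω j ∉ B) ∧ ω n ∈ A} = (1 - ν B) ^ n * ν A := fun n => by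
    have := Measure.infinitePi_pi (μ := fun _ : ℕ => ν) (s := Finset.range (n + 1))
      (t := fun j => if j < n then Bᶜ else A) (fun j _ => by split_ifs; exacts [hB.compl, hA])
    rw [Finset.prod_range_succ, if_neg (lt_irrefl n), Finset.prod_congr rfl
      (fun j hj => by rw [if_pos (Finset.mem_range.1 hj)]), Finset.prod_const, Finset.card_range,
      prob_compl_eq_one_sub hB] at this
    rw [← this]
    congr 1
    ext ω
    simp only [Set.mem_ofPred_eq, Set.mem_pi, Finset.coe_range, Set.mem_Iio]
    constructor
    · rintro ⟨h1, h2⟩ j hj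
      split_ifs with h
      · exact h1 j h
      · rwa [(by lia : j = n)]
    · intro h
      refine ⟨fun j hj => ?_, ?_⟩
      · simpa [hj] using h j (hj.trans n.lt_succ_self)
      · simpa using h n n.lt_succ_self
  have hlt : 1 - ν B < 1 := ENNReal.sub_lt_self (by simp) one_ne_zero hB0
  have hnever : Q {ω | ∀ n, ω n ∉ B} = 0 := by
    refine le_antisymm (ge_of_tendsto' (ENNReal.tendsto_pow_atTop_nhds_zero_of_lt_one hlt)
      fun n => ?_) zero_le
    rw [← hpow n]
    exact measure_mono fun ω hω j _ => hω j
  calc Q _ ≤ Q (⋃ n, {ω | (∀ j < n, ω j ∉ B) ∧ ω n ∈ A}) + Q {ω | ∀ n, ω n ∉ B} := by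
        refine (measure_mono ?_).trans (measure_union_le _ _)
        rintro ω (⟨n, h⟩ | h)
        · exact Or.inl (Set.mem_iUnion.2 ⟨n, h⟩)
        · exact Or.inr h
    _ ≤ ∑' n, (1 - ν B) ^ n * ν A := by
        rw [hnever, add_zero]
        exact (measure_iUnion_le _).trans_eq (tsum_congr hhit)
    _ = ν A / ν B := by
        rw [ENNReal.tsum_mul_right, ENNReal.tsum_geometric,
          ENNReal.sub_sub_cancel ENNReal.one_ne_top prob_le_one, mul_comm, div_eq_mul_inv]

end FirstHit

/-! ### Separation by a single random ball -/

section RandomBall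

open scoped ENNReal RealInnerProductSpace unitInterval

variable {E : Type u} [NormedAddCommGroup E]

/-- The pairs of a centre and a parameter such that the ball they define contains `u`. -/
def ballHits (u : E) : Set (E × I) := {q | 4 * ‖u - q.1‖ ^ 2 ≤ q.2}

theorem dist_le_one_of_mem_ballHits {u v : E} {q : E × I} (hu : q ∈ ballHits u)
    (hv : q ∈ ballHits v) : dist u v ≤ 1 := by
  have key : ∀ w, q ∈ ballHits w → ‖w - q.1‖ ≤ 1 / 2 := fun w hw => by
    have h1 : 4 * ‖w - q.1‖ ^ 2 ≤ 1 := le_trans hw q.2.2.2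
    exact abs_le_of_sq_le_sq' (by linarith) (by norm_num) |>.2
  have := dist_triangle_right u v q.1
  rw [dist_eq_norm u q.1, dist_eq_norm v q.1] at this
  linarith [key u hu, key v hv]

theorem unitInterval_volume_setOf_le {a : ℝ} (ha : 0 ≤ a) :
    volume {s : I | a ≤ s} = ENNReal.ofReal (1 - a) := by
  rcases le_or_gt a 1 with h | h
  · exact unitInterval.volume_Ici ⟨a, ha, h⟩
  · have : {s : I | a ≤ s} = ∅ := by
      ext s
      simpa using s.2.2.trans_lt h
    rw [this, measure_empty, ENNReal.ofReal_of_nonpos (by linarith)]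

theorem unitInterval_volume_setOf_le_lt (a b : ℝ) :
    volume {s : I | a ≤ s ∧ (s : ℝ) < b} ≤ ENNReal.ofReal (b - a) := by
  rw [unitInterval.volume_apply, ← Real.volume_Ico]
  refine measure_mono ?_
  rintro _ ⟨s, hs, rfl⟩
  exact hs

variable [MeasurableSpace E] [BorelSpace E]

theorem measurableSet_ballHits [SecondCountableTopology E] (u : E) : MeasurableSet (ballHits u) :=
  measurableSet_le (by fun_prop) (by fun_prop)

variable [InnerProductSpace ℝ E] [FiniteDimensional ℝ E]

theorem le_measure_ballHits [Nontrivial E] {μ : Measure E} {u : E} {m : ℝ≥0∞}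
    (hm : m • volume.restrict (Metric.closedBall u (1 / 2)) ≤
      μ.restrict (Metric.closedBall u (1 / 2))) :
    m * (ENNReal.ofReal (1 / (6 * Module.finrank ℝ E)) *
      volume (Metric.closedBall (0 : E) (1 / 2))) ≤ μ.prod volume (ballHits u) := by
  rw [Measure.prod_apply (measurableSet_ballHits u)]
  calc _ ≤ m * ∫⁻ y in Metric.closedBall (0 : E) (1 / 2), ENNReal.ofReal (1 - 4 * ‖y‖ ^ 2) := by
        gcongr
        exact le_setLIntegral_closedBall_half_sub_sq
    _ = m * ∫⁻ c in Metric.closedBall u (1 / 2), ENNReal.ofReal (1 - 4 * ‖u - c‖ ^ 2) := by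
        have := (Measure.measurePreserving_sub_left (volume : Measure E) u).setLIntegral_comp_preimage_emb
          (MeasurableEquiv.subLeft u).measurableEmbedding
          (fun y => ENNReal.ofReal (1 - 4 * ‖y‖ ^ 2)) (Metric.closedBall 0 (1 / 2))
        rw [← this]
        congr 3
        ext c
        simp [dist_eq_norm, norm_sub_rev]
    _ = ∫⁻ c, ENNReal.ofReal (1 - 4 * ‖u - c‖ ^ 2)
          ∂(m • volume.restrict (Metric.closedBall u (1 / 2))) := by
        rw [lintegral_smul_measure, smul_eq_mul]
    _ ≤ ∫⁻ c in Metric.closedBall u (1 / 2), ENNReal.ofReal (1 - 4 * ‖u - c‖ ^ 2) ∂μ :=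
        lintegral_mono' hm le_rfl
    _ ≤ ∫⁻ c, ENNReal.ofReal (1 - 4 * ‖u - c‖ ^ 2) ∂μ := setLIntegral_le_lintegral _ _
    _ ≤ _ := lintegral_mono fun c => (unitInterval_volume_setOf_le (by positivity)).ge

theorem measure_ballHits_diff_le [Nontrivial E] {μ : Measure E} {u v : E} {m : ℝ≥0∞}
    (hm : μ.restrict (Metric.closedBall u (1 / 2)) ≤
      m • volume.restrict (Metric.closedBall u (1 / 2)))
    (huv : dist u v * √(Module.finrank ℝ E) ≤ 1) :
    μ.prod volume (ballHits u \ ballHits v) ≤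
      m * (ENNReal.ofReal (8 * dist u v / √(Module.finrank ℝ E)) *
        volume (Metric.closedBall (0 : E) (1 / 2))) := by
  rw [Measure.prod_apply ((measurableSet_ballHits u).diff (measurableSet_ballHits v))]
  rw [dist_comm, dist_eq_norm] at huv ⊢
  set h := v - u with hh
  have hsub : ∀ c, Prod.mk c ⁻¹' (ballHits u \ ballHits v) =
      {s : I | 4 * ‖u - c‖ ^ 2 ≤ s ∧ (s : ℝ) < 4 * ‖v - c‖ ^ 2} := fun c => by
    ext s
    simp [ballHits]
  have hval : ∀ c, 4 * ‖v - c‖ ^ 2 - 4 * ‖u - c‖ ^ 2 = 4 * ‖h‖ ^ 2 - 8 * ⟪h, c - u⟫ := fun c => by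
    have : v - c = h - (c - u) := by rw [hh]; abel
    rw [this, norm_sub_sq_real, norm_sub_rev u c]
    ring
  calc _ ≤ ∫⁻ c, (Metric.closedBall u (1 / 2)).indicator
          (fun c => ENNReal.ofReal (4 * ‖h‖ ^ 2 - 8 * ⟪h, c - u⟫)) c ∂μ := by
        refine lintegral_mono fun c => ?_
        beta_reduce
        rw [hsub]
        by_cases hc : c ∈ Metric.closedBall u (1 / 2)
        · rw [Set.indicator_of_mem hc, ← hval]
          exact unitInterval_volume_setOf_le_lt _ _
        -- A centre farther than 1/2 from `u` never captures it, since `s ≤ 1`.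
        · have : {s : I | 4 * ‖u - c‖ ^ 2 ≤ s ∧ (s : ℝ) < 4 * ‖v - c‖ ^ 2} = ∅ := by
            ext s
            simp only [Set.mem_ofPred_eq, Set.mem_empty_iff_false, iff_false, not_and]
            intro hs
            rw [Metric.mem_closedBall, dist_comm, dist_eq_norm, not_le] at hc
            nlinarith [s.2.2]
          rw [this, measure_empty]
          exact zero_le
    _ = ∫⁻ c in Metric.closedBall u (1 / 2), ENNReal.ofReal (4 * ‖h‖ ^ 2 - 8 * ⟪h, c - u⟫) ∂μ :=
        lintegral_indicator Metric.isClosed_closedBall.measurableSet _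
    _ ≤ ∫⁻ c, ENNReal.ofReal (4 * ‖h‖ ^ 2 - 8 * ⟪h, c - u⟫)
          ∂(m • volume.restrict (Metric.closedBall u (1 / 2))) := lintegral_mono' hm le_rfl
    _ = m * ∫⁻ c in Metric.closedBall u (1 / 2), ENNReal.ofReal (4 * ‖h‖ ^ 2 - 8 * ⟪h, c - u⟫) := by
        rw [lintegral_smul_measure, smul_eq_mul]
    _ = m * ∫⁻ y in Metric.closedBall 0 (1 / 2), ENNReal.ofReal (4 * ‖h‖ ^ 2 - 8 * ⟪h, y⟫) := by
        have := (measurePreserving_sub_right (volume : Measure E) u).setLIntegral_comp_preimage_emb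
          (MeasurableEquiv.subRight u).measurableEmbedding
          (fun y => ENNReal.ofReal (4 * ‖h‖ ^ 2 - 8 * ⟪h, y⟫)) (Metric.closedBall 0 (1 / 2))
        rw [← this]
        congr 3
        ext c
        simp [dist_eq_norm]
    _ ≤ _ := by
        gcongr
        exact setLIntegral_closedBall_half_sub_inner_le huv

/-- The probability that a random ball separates `u` from `v`, relative to the probability that it
contains `u`. -/
theorem measure_ballHits_diff_le_mul [Nontrivial E] {μ : Measure E} {u v : E} {m : ℝ≥0∞}
    (hm : m • volume.restrict (Metric.closedBall u (1 / 2)) ≤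
      μ.restrict (Metric.closedBall u (1 / 2)))
    (hm' : μ.restrict (Metric.closedBall u (1 / 2)) ≤
      (3 * m) • volume.restrict (Metric.closedBall u (1 / 2)))
    (huv : dist u v * √(Module.finrank ℝ E) ≤ 1) :
    μ.prod volume (ballHits u \ ballHits v) ≤
      ENNReal.ofReal (144 * √(Module.finrank ℝ E) * dist u v) * μ.prod volume (ballHits u) := by
  refine (measure_ballHits_diff_le hm' huv).trans (le_trans (le_of_eq ?_)
    (mul_le_mul_right (le_measure_ballHits hm) _))
  have hn0 : 0 < (Module.finrank ℝ E : ℝ) := Nat.cast_pos.2 Module.finrank_pos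
  have hs : 0 < √(Module.finrank ℝ E : ℝ) := Real.sqrt_pos.2 hn0
  have hs2 : √(Module.finrank ℝ E : ℝ) ^ 2 = Module.finrank ℝ E := Real.sq_sqrt hn0.le
  have h3 : (3 : ℝ≥0∞) = ENNReal.ofReal 3 := by norm_num
  have key : (3 : ℝ≥0∞) * ENNReal.ofReal (8 * dist u v / √(Module.finrank ℝ E)) =
      ENNReal.ofReal (144 * √(Module.finrank ℝ E) * dist u v) *
        ENNReal.ofReal (1 / (6 * Module.finrank ℝ E)) := by
    rw [h3, ← ENNReal.ofReal_mul (by norm_num), ← ENNReal.ofReal_mul (by positivity)]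
    congr 1
    field_simp
    rw [hs2]
    ring
  rw [mul_comm 3 m, mul_assoc, ← mul_assoc 3, key]
  ring

end RandomBall

/-! ### Expected distance between addresses -/

section Expectation

variable {E : Type u} [NormedAddCommGroup E] [NormedSpace ℝ E] {K : Type v} {k₀ : K}
  {Ω : Type*} [MeasurableSpace Ω] {P : Measure Ω} [IsProbabilityMeasure P] {κ : Ω → E → K}

theorem measurable_dist_address (hκ : ∀ ω, IsUnitPartition (κ ω) k₀)
    (hmeas : ∀ u v, MeasurableSet {ω | κ ω u = κ ω v}) (u v : E) :
    Measurable fun ω => dist ((hκ ω).address u) ((hκ ω).address v) := by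
  simp only [AddressSpace.dist_eq_iSup]
  refine Measurable.iSup fun i => ?_
  exact (Measurable.ite (hmeas ((2 : ℝ) ^ (-i) • u) ((2 : ℝ) ^ (-i) • v))
    (measurable_const (a := (0 : ℝ))) (measurable_const (a := (2 : ℝ) ^ (i + 1))))

/-- If a random partition separates two points with probability at most `c` times their distance,
then the distance between their addresses is at most of order `c` times the number of scales
between their distance and their norms, in expectation and relative to their distance. -/
theorem integral_dist_address_le (hκ : ∀ ω, IsUnitPartition (κ ω) k₀)
    (hmeas : ∀ u v, MeasurableSet {ω | κ ω u = κ ω v}) {c : ℝ} (hc : 0 ≤ c)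
    (hcut : ∀ u v, P.real {ω | κ ω u ≠ κ ω v} ≤ c * dist u v) {u v : E} (huv : u ≠ v) {M : ℝ}
    (hu : ‖u‖ ≤ M) (hv : ‖v‖ ≤ M) :
    Integrable (fun ω => dist ((hκ ω).address u) ((hκ ω).address v)) P ∧
      ∫ ω, dist ((hκ ω).address u) ((hκ ω).address v) ∂P ≤
        (2 + 2 * c * (3 + Real.logb 2 (M / dist u v))) * dist u v := by
  classical
  set D := dist u v with hD
  have hD0 : 0 < D := dist_pos.2 huv
  have hDM : D ≤ 2 * M := by
    have := norm_sub_le u v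
    rw [hD, dist_eq_norm]
    linarith
  have hM0 : 0 < M := by linarith
  set m := Int.log 2 D with hm
  -- Above scale `N` both rescaled points have norm at most 1/4 and so lie in the cell of the
  -- origin.
  set N := Int.log 2 (4 * M) with hN
  have hmD : (2 : ℝ) ^ m ≤ D := by exact_mod_cast Int.zpow_log_le_self one_lt_two hD0
  have hDm : D < (2 : ℝ) ^ (m + 1) := by exact_mod_cast Int.lt_zpow_succ_log_self one_lt_two D
  have hNM : (2 : ℝ) ^ N ≤ 4 * M := by
    exact_mod_cast Int.zpow_log_le_self one_lt_two (by positivity : 0 < 4 * M)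
  have hMN : 4 * M < (2 : ℝ) ^ (N + 1) := by
    exact_mod_cast Int.lt_zpow_succ_log_self one_lt_two (4 * M)
  have hmN : m ≤ N := Int.log_mono_right hD0 (by linarith)
  have hjoin : ∀ ω i, N < i → ((hκ ω).address u).1 i = ((hκ ω).address v).1 i := fun ω i hi => by
    have hi' : (2 : ℝ) ^ (N + 1) ≤ 2 ^ i := zpow_le_zpow_right₀ one_le_two (by lia)
    have key : ∀ w : E, ‖w‖ ≤ M → κ ω ((2 : ℝ) ^ (-i) • w) = k₀ := fun w hw => by
      refine (hκ ω).eq_of_norm_le _ ?_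
      rw [norm_smul, Real.norm_of_nonneg (by positivity), zpow_neg,
        inv_mul_le_iff₀ (by positivity)]
      linarith
    exact (key u hu).trans (key v hv).symm
  set A : ℤ → Set Ω := fun i => {ω | κ ω ((2 : ℝ) ^ (-i) • u) ≠ κ ω ((2 : ℝ) ^ (-i) • v)} with hA
  have hAm : ∀ i, MeasurableSet (A i) := fun i => (hmeas _ _).compl
  have hscale : ∀ ω i, AddressSpace.scaleDist ((hκ ω).address u) ((hκ ω).address v) i =
      (A i).indicator (fun _ => (2 : ℝ) ^ (i + 1)) ω := fun ω i => by
    by_cases h : ω ∈ A i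
    · exact (if_neg h).trans (Set.indicator_of_mem h fun _ => (2 : ℝ) ^ (i + 1)).symm
    · exact (if_pos (not_not.1 h)).trans (Set.indicator_of_notMem h fun _ => (2 : ℝ) ^ (i + 1)).symm
  set g : Ω → ℝ := fun ω => 2 ^ (m + 1) +
    ∑ i ∈ Finset.Icc (m + 1) N, (A i).indicator (fun _ => (2 : ℝ) ^ (i + 1)) ω with hg
  have hle : ∀ ω, dist ((hκ ω).address u) ((hκ ω).address v) ≤ g ω := fun ω => by
    have := AddressSpace.dist_le_add_sum (m := m) (hjoin ω)
    simpa only [hscale] using this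
  have hint : ∀ i, Integrable ((A i).indicator fun _ => (2 : ℝ) ^ (i + 1)) P := fun i =>
    (integrable_const _).indicator (hAm i)
  have hgint : Integrable g P :=
    (integrable_const _).add (integrable_finsetSum _ fun i _ => hint i)
  have hfint : Integrable (fun ω => dist ((hκ ω).address u) ((hκ ω).address v)) P :=
    hgint.mono' (measurable_dist_address hκ hmeas u v).aestronglyMeasurable
      (Filter.Eventually.of_forall fun ω => by
        rw [Real.norm_of_nonneg dist_nonneg]
        exact hle ω)
  refine ⟨hfint, ?_⟩
  have hcard : ((Finset.Icc (m + 1) N).card : ℝ) = N - m := by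
    rw [Int.card_Icc]
    have : ((N + 1 - (m + 1)).toNat : ℤ) = N - m := by lia
    exact_mod_cast this
  have hlog : (N : ℝ) - m ≤ 3 + Real.logb 2 (M / D) := by
    have h1 : (N : ℝ) ≤ Real.logb 2 (4 * M) := by
      rw [Real.le_logb_iff_rpow_le one_lt_two (by positivity), Real.rpow_intCast]
      exact hNM
    have h2 : Real.logb 2 D ≤ m + 1 := by
      rw [Real.logb_le_iff_le_rpow one_lt_two hD0]
      exact_mod_cast hDm.le
    have h4 : Real.logb 2 4 = 2 := by
      rw [show (4 : ℝ) = 2 ^ (2 : ℝ) by norm_num, Real.logb_rpow (by norm_num) (by norm_num)]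
    rw [Real.logb_mul (by norm_num) hM0.ne', h4] at h1
    rw [Real.logb_div hM0.ne' hD0.ne']
    linarith
  calc ∫ ω, dist ((hκ ω).address u) ((hκ ω).address v) ∂P ≤ ∫ ω, g ω ∂P :=
        integral_mono hfint hgint hle
    _ = 2 ^ (m + 1) + ∑ i ∈ Finset.Icc (m + 1) N, P.real (A i) * 2 ^ (i + 1) := by
        rw [hg, integral_add (integrable_const _) (integrable_finsetSum _ fun i _ => hint i),
          integral_finsetSum _ fun i _ => hint i]
        simp [integral_indicator_const _ (hAm _)]
    _ ≤ 2 * D + ∑ i ∈ Finset.Icc (m + 1) N, 2 * c * D := by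
        refine add_le_add ?_ (Finset.sum_le_sum fun i _ => ?_)
        · rw [zpow_add_one₀ two_ne_zero]
          linarith
        -- The dilation factor cancels: every scale contributes equally.
        · calc P.real (A i) * 2 ^ (i + 1) ≤ c * (2 ^ (-i) * D) * 2 ^ (i + 1) := by
                gcongr
                refine (hcut _ _).trans (le_of_eq ?_)
                rw [dist_smul₀, Real.norm_of_nonneg (by positivity)]
            _ = 2 * c * D := by
                rw [zpow_neg, zpow_add_one₀ two_ne_zero]
                field_simp
    _ = 2 * D + (N - m) * (2 * c * D) := by rw [Finset.sum_const, nsmul_eq_mul, hcard]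
    _ ≤ 2 * D + (3 + Real.logb 2 (M / D)) * (2 * c * D) := by gcongr
    _ = _ := by ring

end Expectation

/-! ### The random partition -/

section RandomPartition

open scoped ENNReal unitInterval

variable {E : Type u} [NormedAddCommGroup E]

/-- A ball about the origin of random radius, followed by a sequence of random balls. -/
def randomBalls (ω : (ℕ → E × I) × I) : ℕ → Set E
  | 0 => {u | 4 * ‖u‖ ≤ 1 + ω.2}
  | n + 1 => {u | ω.1 n ∈ ballHits u}

/-- The radius of the ball about the origin lies between 1/4 and 1/2, which gives both the
guaranteed central ball and the diameter bound. -/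
theorem isUnitPartition_carvingLabel_randomBalls (ω : (ℕ → E × I) × I) :
    IsUnitPartition (carvingLabel (randomBalls ω)) (Sum.inl 0) where
  dist_le_one u v := by
    refine dist_le_one_of_carvingLabel_eq fun n u hu v hv => ?_
    cases n with
    | zero =>
      have hu' : 4 * ‖u‖ ≤ 1 + ω.2 := hu
      have hv' : 4 * ‖v‖ ≤ 1 + ω.2 := hv
      have := norm_sub_le u v
      rw [dist_eq_norm]
      linarith [ω.2.2.2]
    | succ n => exact dist_le_one_of_mem_ballHits hu hv
  eq_of_norm_le u hu := carvingLabel_eq_inl_iff.2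
    ⟨show 4 * ‖u‖ ≤ 1 + ω.2 by linarith [ω.2.2.1], by simp⟩

theorem unitInterval_volume_norm_separates_le (u v : E) :
    volume {t : I | (4 * ‖u‖ ≤ 1 + t ∧ ¬ 4 * ‖v‖ ≤ 1 + t) ∨ (4 * ‖v‖ ≤ 1 + t ∧ ¬ 4 * ‖u‖ ≤ 1 + t)} ≤
      ENNReal.ofReal (4 * dist u v) := by
  wlog huv : ‖u‖ ≤ ‖v‖ generalizing u v
  · rw [dist_comm]
    refine le_trans (measure_mono fun t ht => ?_) (this v u (le_of_not_ge huv))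
    exact Or.symm ht
  refine (measure_mono fun t ht => ?_).trans ((unitInterval_volume_setOf_le_lt
    (4 * ‖u‖ - 1) (4 * ‖v‖ - 1)).trans (ENNReal.ofReal_le_ofReal ?_))
  · rcases ht with ⟨h1, h2⟩ | ⟨h1, h2⟩
    · exact ⟨by linarith, by linarith⟩
    · exact absurd (by linarith) h2
  · have := norm_sub_norm_le v u
    rw [dist_comm, dist_eq_norm]
    linarith

variable [MeasurableSpace E] [BorelSpace E]

theorem measurableSet_mem_randomBalls [SecondCountableTopology E] (n : ℕ) (u : E) :
    MeasurableSet {ω : (ℕ → E × I) × I | u ∈ randomBalls ω n} := by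
  cases n with
  | zero =>
    exact measurableSet_le (f := fun _ => 4 * ‖u‖) (g := fun ω : (ℕ → E × I) × I => 1 + (ω.2 : ℝ))
      (by fun_prop) (by fun_prop)
  | succ n =>
    exact measurableSet_preimage (f := fun ω : (ℕ → E × I) × I => ω.1 n) (by fun_prop)
      (measurableSet_ballHits u)

variable [InnerProductSpace ℝ E] [FiniteDimensional ℝ E]

/-- Ball carving with randomly placed balls separates two points with probability at most of order
the square root of the dimension times their distance. -/
theorem exists_measure_carvingLabel_ne_le :
    ∃ P : Measure ((ℕ → E × I) × I), IsProbabilityMeasure P ∧ ∀ u v : E,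
      P.real {ω | carvingLabel (randomBalls ω) u ≠ carvingLabel (randomBalls ω) v} ≤
        300 * √(Module.finrank ℝ E) * dist u v := by
  obtain ⟨μ, hμ, hcomp⟩ := exists_isProbabilityMeasure_comparable_volume (E := E)
  set ν : Measure (E × I) := μ.prod volume
  set Q := Measure.infinitePi fun _ : ℕ => ν
  refine ⟨Q.prod volume, inferInstance, fun u v => ?_⟩
  rcases eq_or_ne u v with rfl | huv
  · simp
  have : Nontrivial E := ⟨u, v, huv⟩
  have hn : (1 : ℝ) ≤ √(Module.finrank ℝ E) :=
    Real.one_le_sqrt.2 (Nat.one_le_cast.2 Module.finrank_pos)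
  -- For distant points the claimed bound exceeds 1.
  rcases le_or_gt (dist u v * √(Module.finrank ℝ E)) 1 with hd | hd
  swap
  · refine measureReal_le_one.trans ?_
    nlinarith
  set A := ballHits u \ ballHits v ∪ ballHits v \ ballHits u with hA
  set B := ballHits u ∪ ballHits v with hB
  have hAm : MeasurableSet A := ((measurableSet_ballHits u).diff (measurableSet_ballHits v)).union
    ((measurableSet_ballHits v).diff (measurableSet_ballHits u))
  have hBm : MeasurableSet B := (measurableSet_ballHits u).union (measurableSet_ballHits v)
  set δ := ENNReal.ofReal (144 * √(Module.finrank ℝ E) * dist u v) with hδ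
  have hdiff : ∀ w z : E, dist w z = dist u v →
      ν (ballHits w \ ballHits z) ≤ δ * ν (ballHits w) := fun w z hwz => by
    obtain ⟨m, -, -, hm, hm'⟩ := hcomp w
    rw [hδ, ← hwz]
    exact measure_ballHits_diff_le_mul hm hm' (hwz ▸ hd)
  have hAB : ν A ≤ (δ + δ) * ν B := by
    rw [add_mul]
    refine (measure_union_le _ _).trans (add_le_add ?_ ?_)
    · exact (hdiff u v rfl).trans (by gcongr; exact Set.subset_union_left)
    · exact (hdiff v u (dist_comm _ _)).trans (by gcongr; exact Set.subset_union_right)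
  have hB0 : ν B ≠ 0 := by
    obtain ⟨m, hm0, -, hm, -⟩ := hcomp u
    refine ne_of_gt (lt_of_lt_of_le (pos_iff_ne_zero.2 ?_)
      ((le_measure_ballHits hm).trans (measure_mono Set.subset_union_left)))
    refine mul_ne_zero hm0 (mul_ne_zero ?_ ?_)
    · have : 0 < (Module.finrank ℝ E : ℝ) := Nat.cast_pos.2 Module.finrank_pos
      exact (ENNReal.ofReal_pos.2 (by positivity)).ne'
    · exact (Metric.measure_closedBall_pos _ _ (by norm_num)).ne'
  have hcarve := (infinitePi_first_hit_le ν hAm hBm hB0).trans (ENNReal.div_le_of_le_mul hAB)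
  set U : Set (ℕ → E × I) := {ω | (∃ n, (∀ j < n, ω j ∉ B) ∧ ω n ∈ A) ∨ ∀ n, ω n ∉ B} with hU
  set W : Set I := {t : I | (4 * ‖u‖ ≤ 1 + t ∧ ¬ 4 * ‖v‖ ≤ 1 + t) ∨
    (4 * ‖v‖ ≤ 1 + t ∧ ¬ 4 * ‖u‖ ≤ 1 + t)} with hW
  -- Separation is due either to the central ball (`W`) or to the first sampled ball meeting the
  -- pair, if there is one (`U`). Set `n + 1` of the carving is sample `n`.
  have hsub : {ω | carvingLabel (randomBalls ω) u ≠ carvingLabel (randomBalls ω) v} ⊆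
      U ×ˢ Set.univ ∪ Set.univ ×ˢ W := by
    intro ω hω
    have hBn : ∀ n, u ∉ randomBalls ω (n + 1) ∧ v ∉ randomBalls ω (n + 1) → ω.1 n ∉ B :=
      fun n h => not_or.2 h
    rcases exists_separating_of_carvingLabel_ne hω with ⟨n, hn, hsep⟩ | hnever
    · cases n with
      | zero => exact Or.inr ⟨trivial, hsep⟩
      | succ n => exact Or.inl ⟨Or.inl ⟨n, fun j hj => hBn j (hn (j + 1) (by lia)), hsep⟩, trivial⟩
    · exact Or.inl ⟨Or.inr fun n => hBn n (hnever (n + 1)), trivial⟩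
  refine ENNReal.toReal_le_of_le_ofReal (by positivity) ?_
  calc Q.prod volume _ ≤ Q.prod volume (U ×ˢ Set.univ) + Q.prod volume (Set.univ ×ˢ W) :=
        (measure_mono hsub).trans (measure_union_le _ _)
    _ ≤ (δ + δ) + ENNReal.ofReal (4 * dist u v) := by
        rw [Measure.prod_prod, Measure.prod_prod, measure_univ, measure_univ, mul_one, one_mul]
        exact add_le_add hcarve (unitInterval_volume_norm_separates_le u v)
    _ ≤ _ := by
        rw [hδ, ← ENNReal.ofReal_add (by positivity) (by positivity),
          ← ENNReal.ofReal_add (by positivity) (by positivity)]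
        refine ENNReal.ofReal_le_ofReal ?_
        nlinarith [dist_nonneg (x := u) (y := v)]

end RandomPartition

/-! ### The main theorem -/

theorem mainTheorem5 :
    ∃ C : ℝ, 0 < C ∧ ∀ d : ℕ,
      ∃ (Ω : Type) (_ : MeasurableSpace Ω) (P : Measure Ω) (_ : IsProbabilityMeasure P)
        (Y : Type) (_ : MetricSpace Y) (_ : IsUltrametricDist Y)
        (A : Ω → OnlineEmbedding (EuclideanSpace ℝ (Fin d)) Y),
        (∀ ω, (A ω).IsDominating) ∧
        (∀ ω, (A ω).IsIntoHST 2) ∧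
        HasExpectedDistortion P A
          (fun x => C * Real.sqrt d * (1 + Real.log (aspectRatio x))) := by
  -- `1802 = 2 + 2 * 300 * 3`, from the constants of `integral_dist_address_le` and the cut
  -- probability.
  refine ⟨1802, by norm_num, fun d => ?_⟩
  obtain ⟨P, hP, hcut⟩ := exists_measure_carvingLabel_ne_le (E := EuclideanSpace ℝ (Fin d))
  rw [finrank_euclideanSpace_fin] at hcut
  have hκ := isUnitPartition_carvingLabel_randomBalls (E := EuclideanSpace ℝ (Fin d))
  let Y := AddressSpace (Sum.inl 0 : ℕ ⊕ EuclideanSpace ℝ (Fin d))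
  refine ⟨_, inferInstance, P, hP, Y, inferInstance, inferInstance,
    fun ω => OnlineEmbedding.ofMap (hκ ω).address, fun ω n x p q => ?_, fun ω n x hn => ?_,
    fun n x p q => ?_⟩
  · obtain ⟨c, -, hc⟩ := OnlineEmbedding.exists_embed_ofMap_eq Y x p
    rw [hc, hc]
    refine le_trans (le_of_eq ?_) ((hκ ω).dist_le_dist_address _ _)
    rw [dist_sub_right, Subtype.dist_eq]
  · exact AddressSpace.isHST_of_finite _ (Set.finite_range _) ⟨_, ⟨x ⟨0, hn⟩, ⟨0, hn⟩, rfl⟩, rfl⟩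
  · rcases eq_or_ne p q with rfl | hpq
    · simp
    have hpq' : (p : EuclideanSpace ℝ (Fin d)) ≠ q := fun h => hpq (Subtype.ext h)
    obtain ⟨c, hc, hembed⟩ := OnlineEmbedding.exists_embed_ofMap_eq Y x p
    simp only [hembed]
    have hbdd : Bornology.IsBounded (Set.range x) := (Set.finite_range x).isBounded
    have hnorm : ∀ r : Set.range x, ‖(r : EuclideanSpace ℝ (Fin d)) - c‖ ≤
        Metric.diam (Set.range x) := fun r => by
      rw [← dist_eq_norm]
      exact Metric.dist_le_diam_of_mem hbdd r.2 hc
    obtain ⟨hint, hle⟩ := integral_dist_address_le hκ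
      (measurableSet_carvingLabel_eq measurableSet_mem_randomBalls) (by positivity) hcut
      (sub_left_injective.ne hpq' : (p : EuclideanSpace ℝ (Fin d)) - c ≠ q - c) (hnorm p) (hnorm q)
    refine ⟨hint, hle.trans ?_⟩
    rw [dist_sub_right, ← Subtype.dist_eq]
    have hd : (1 : ℝ) ≤ √d := by
      refine Real.one_le_sqrt.2 (Nat.one_le_cast.2 (Nat.pos_of_ne_zero ?_))
      rintro rfl
      exact hpq' (Subsingleton.elim _ _)
    have hD0 : 0 < dist p q := dist_pos.2 hpq
    have hsep0 : 0 < (Set.range x).infsep :=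
      (Set.finite_range x).infsep_pos_iff_nontrivial.2 ⟨p, p.2, q, q.2, hpq'⟩
    have hsep : (Set.range x).infsep ≤ dist p q := by
      have hnt : (Set.range x).Nontrivial := ⟨p, p.2, q, q.2, hpq'⟩
      exact (Set.Nontrivial.le_infsep_iff hnt).1 le_rfl p p.2 q q.2 hpq'
    have hdiam : dist p q ≤ Metric.diam (Set.range x) := Metric.dist_le_diam_of_mem hbdd p.2 q.2
    have hΦ : Metric.diam (Set.range x) / dist p q ≤ aspectRatio x :=
      div_le_div_of_nonneg_left Metric.diam_nonneg hsep0 hsep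
    have hone : 1 ≤ Metric.diam (Set.range x) / dist p q := (one_le_div hD0).2 hdiam
    have hL0 : 0 ≤ Real.log (aspectRatio x) := Real.log_nonneg (hone.trans hΦ)
    -- The factor 2 absorbs the change of base, since `log 2 > 1/2`.
    have hlogb : Real.logb 2 (Metric.diam (Set.range x) / dist p q) ≤
        2 * Real.log (aspectRatio x) := by
      rw [Real.logb, div_le_iff₀ (Real.log_pos one_lt_two)]
      have h1 := Real.log_le_log (by linarith) hΦ
      nlinarith [Real.log_two_gt_d9]
    gcongr
    calc 2 + 2 * (300 * √d) * (3 + Real.logb 2 (Metric.diam (Set.range x) / dist p q))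
        ≤ 2 * √d + 2 * (300 * √d) * (3 + 2 * Real.log (aspectRatio x)) := by
          gcongr
          linarith
      _ ≤ 1802 * √d * (1 + Real.log (aspectRatio x)) := by
          nlinarith [mul_nonneg (Real.sqrt_nonneg d) hL0]
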